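/- For $a,b\in\mathbb{R}^n$ and $g\in L^2(\mathbb{R}^n)$ (complex-valued) let $T_a g(x)=g(x-a)$ and $M_b g(x)=e^{2\pi i\langle x,b\rangle}g(x)$. For a set $\Lambda\subseteq\mathbb{R}^n\times\mathbb{R}^n$ let $\mathcal{G}(g,\Lambda)=\{M_bT_a g\}_{(a,b)\in\Lambda}$ be the Gabor system generated by $g$ and $\Lambda$. A family $\{f_i\}_{i\in I}$ in a Hilbert space $\mathcal{H}$ is called Bessel if there is a constant $B>0$ such that $\sum_{i\in I}|\langle f,f_i\rangle|^2\le B\|f\|^2$ for all $f\in\mathcal{H}$. **Proposition 4.1.** Let $d>1$ and $r$ be natural numbers, and let $$g=\sum_{k=1}^{r}\bigotimes_{j=1}^{d}g_{j,k}\in L^2(\mathbb{R}^d),$$ where, for each $j\in\{1,\dots,d\}$, the functions $g_{j,1},\dots,g_{j,r}\in L^2(\mathbb{R})$ are linearly independent over $\mathbb{C}$, and $\bigotimes_{j=1}^d g_{j,k}$ is the function $x\mapsto\prod_{j=1}^d g_{j,k}(x_j)$. Let $\Lambda_1,\dots,\Lambda_d\subseteq\mathbb{R}\times\mathbb{R}$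 be nonempty sets and let $$\prod_{j=1}^d\Lambda_j=\{(a,b)\in\mathbb{R}^d\times\mathbb{R}^d:(a_j,b_j)\in\Lambda_j\text{ for all }j\}.$$ Then $\mathcal{G}\bigl(g,\prod_{j=1}^d\Lambda_j\bigr)$ is Bessel in $L^2(\mathbb{R}^d)$ if and only if $\mathcal{G}(g_{j,k},\Lambda_j)$ is Bessel in $L^2(\mathbb{R})$ for each $(j,k)\in\{1,\dots,d\}\times\{1,\dots,r\}$. -/

import Mathlib

open MeasureTheory

/-- A family `F` in a complex Hilbert space is Bessel if there is `B > 0` with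
`∑ |⟨f, F i⟩|² ≤ B ‖f‖²` for all `f` (the sum of nonnegative terms being finite). -/
def IsBessel {ι H : Type*} [NormedAddCommGroup H] [InnerProductSpace ℂ H] (F : ι → H) : Prop :=
  ∃ B : ℝ, 0 < B ∧ ∀ f : H,
    Summable (fun i => ‖inner ℂ (F i) f‖ ^ 2) ∧ ∑' i, ‖inner ℂ (F i) f‖ ^ 2 ≤ B * ‖f‖ ^ 2

section TimeFrequency

variable {E : Type*} [NormedAddCommGroup E] [InnerProductSpace ℝ E] [FiniteDimensional ℝ E]
  [MeasurableSpace E] [BorelSpace E]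

/-- The function `M_b T_a g`, that is `x ↦ e^{2 π i ⟨x, b⟩} g (x - a)`. -/
noncomputable def tfShiftFun (a b : E) (g : E → ℂ) : E → ℂ :=
  fun x => Complex.exp (2 * Real.pi * Complex.I * ((inner ℝ x b : ℝ) : ℂ)) * g (x - a)

theorem memLp_tfShiftFun (a b : E) {g : E → ℂ} (hg : MemLp g 2 (volume : Measure E)) :
    MemLp (tfShiftFun a b g) 2 (volume : Measure E) := by
  have h1 : MemLp (fun x => g (x - a)) 2 (volume : Measure E) :=
    hg.comp_measurePreserving (measurePreserving_sub_right volume a)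
  have hc : Continuous fun x : E =>
      Complex.exp (2 * Real.pi * Complex.I * ((inner ℝ x b : ℝ) : ℂ)) := by fun_prop
  refine h1.of_le (hc.aestronglyMeasurable.mul h1.aestronglyMeasurable)
    (Filter.Eventually.of_forall fun x => ?_)
  have he : ‖Complex.exp (2 * Real.pi * Complex.I * ((inner ℝ x b : ℝ) : ℂ))‖ = 1 := by
    rw [Complex.norm_exp]
    simp
  simp only [tfShiftFun, norm_mul, he, one_mul, le_refl]

/-- The time-frequency shift `M_b T_a` of an element of `L²(E)`. -/
noncomputable def tfShift (a b : E) (g : Lp ℂ 2 (volume : Measure E)) :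
    Lp ℂ 2 (volume : Measure E) :=
  (memLp_tfShiftFun a b (Lp.memLp g)).toLp (tfShiftFun a b g)

/-- The Gabor system `𝒢(g, Λ) = {M_b T_a g : (a, b) ∈ Λ}`, as a family indexed by `Λ`. -/
noncomputable def gaborSystem (g : Lp ℂ 2 (volume : Measure E)) (Λ : Set (E × E)) :
    Λ → Lp ℂ 2 (volume : Measure E) :=
  fun p => tfShift p.1.1 p.1.2 g

end TimeFrequency

theorem memLp_tensorFun {d : ℕ} (g : Fin d → Lp ℂ 2 (volume : Measure ℝ)) :
    MemLp (fun x : EuclideanSpace ℝ (Fin d) => ∏ j, g j (x j)) 2 volume := by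
  have hm : AEStronglyMeasurable (fun x : Fin d → ℝ => ∏ j, g j (x j)) volume := by
    refine Finset.aestronglyMeasurable_fun_prod _ fun j _ => ?_
    exact (Lp.aestronglyMeasurable (g j)).comp_quasiMeasurePreserving
      (Measure.quasiMeasurePreserving_eval (fun _ : Fin d => (volume : Measure ℝ)) j)
  have h : MemLp (fun x : Fin d → ℝ => ∏ j, g j (x j)) 2 volume := by
    rw [memLp_two_iff_integrable_sq_norm hm]
    have h2 : ∀ j, Integrable (fun x : ℝ => ‖g j x‖ ^ 2) volume := fun j =>
      (memLp_two_iff_integrable_sq_norm (Lp.aestronglyMeasurable (g j))).1 (Lp.memLp (g j))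
    have h3 := Integrable.fintype_prod (f := fun j (x : ℝ) => ‖g j x‖ ^ 2)
      (μ := fun _ : Fin d => (volume : Measure ℝ)) h2
    simp only [norm_prod, ← Finset.prod_pow]
    exact h3
  exact h.comp_measurePreserving (PiLp.volume_preserving_ofLp (Fin d))

/-- The tensor product `g₁ ⊗ ⋯ ⊗ g_d` in `L²(ℝᵈ)`: the class of `x ↦ g₁(x₁) ⋯ g_d(x_d)`. -/
noncomputable def tensorLp {d : ℕ} (g : Fin d → Lp ℂ 2 (volume : Measure ℝ)) :
    Lp ℂ 2 (volume : Measure (EuclideanSpace ℝ (Fin d))) :=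
  (memLp_tensorFun g).toLp (fun x => ∏ j, g j (x j))

/-- The product `∏ Λ_j ⊆ ℝᵈ × ℝᵈ` of sets `Λ_j ⊆ ℝ × ℝ`. -/
def timeFreqProd {d : ℕ} (Λ : Fin d → Set (ℝ × ℝ)) :
    Set (EuclideanSpace ℝ (Fin d) × EuclideanSpace ℝ (Fin d)) :=
  {p | ∀ j, (p.1 j, p.2 j) ∈ Λ j}

/-! ### Bessel families, Gram matrices and Schur products -/

section Bessel

open scoped ComplexOrder Matrix

variable {ι κ H : Type*} [NormedAddCommGroup H] [InnerProductSpace ℂ H]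

/-! Time-frequency shifts act factorwise on tensors, so the system of `g` is a sum over `k` of
families of pure tensors, whose inner products are products over `j`.

If all factors are Bessel, each pure tensor family is Bessel: a family is Bessel exactly when its
Gram matrix is at most `B • 1`, and Schur's product theorem lets such bounds be multiplied entrywise
(`posSemidef_finset_prod_sub_prod`, `IsBessel.of_inner_eq_prod`). Finite sums of Bessel families are
Bessel.

Conversely, freeze one point of `Λ j` for every `j ≠ j₀` and test against tensors with a free factor
`f` at `j₀`. As `d > 1`, some `j₁ ≠ j₀` exists, and a factor there biorthogonal to the shifted `gf
j₁ l` kills every term but `k₀`. What remains is a nonzero constant times the coefficients of `f` in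
the system of `gf j₀ k₀`. -/

theorem isBessel_iff_finset_sum_le {F : ι → H} :
    IsBessel F ↔ ∃ B : ℝ, 0 < B ∧ ∀ (f : H) (s : Finset ι),
      ∑ i ∈ s, ‖inner ℂ (F i) f‖ ^ 2 ≤ B * ‖f‖ ^ 2 := by
  refine exists_congr fun B => and_congr_right fun _ => forall_congr' fun f => ⟨fun h s => ?_,
    fun h => ⟨summable_of_sum_le (fun _ => by positivity) h,
      Real.tsum_le_of_sum_le (fun _ => by positivity) h⟩⟩
  exact (h.1.sum_le_tsum s fun _ _ => by positivity).trans h.2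

theorem IsBessel.zero : IsBessel (0 : ι → H) :=
  isBessel_iff_finset_sum_le.2 ⟨1, one_pos, fun f s => by simp⟩

theorem IsBessel.add {F G : ι → H} (hF : IsBessel F) (hG : IsBessel G) : IsBessel (F + G) := by
  rw [isBessel_iff_finset_sum_le] at *
  obtain ⟨B, hB, hF⟩ := hF
  obtain ⟨C, hC, hG⟩ := hG
  refine ⟨2 * (B + C), by positivity, fun f s => ?_⟩
  have key : ∀ i ∈ s, ‖inner ℂ ((F + G) i) f‖ ^ 2 ≤
      2 * (‖inner ℂ (F i) f‖ ^ 2 + ‖inner ℂ (G i) f‖ ^ 2) := fun i _ => by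
    rw [Pi.add_apply, inner_add_left]
    have h := norm_add_le (inner ℂ (F i) f) (inner ℂ (G i) f)
    nlinarith [norm_nonneg (inner ℂ (F i) f + inner ℂ (G i) f),
      sq_nonneg (‖inner ℂ (F i) f‖ - ‖inner ℂ (G i) f‖)]
  refine (Finset.sum_le_sum key).trans ?_
  rw [← Finset.mul_sum, Finset.sum_add_distrib]
  linarith [hF f s, hG f s]

theorem IsBessel.sum {F : κ → ι → H} (s : Finset κ) (hF : ∀ k ∈ s, IsBessel (F k)) :
    IsBessel (∑ k ∈ s, F k) :=
  Finset.sum_induction F IsBessel (fun _ _ => IsBessel.add) IsBessel.zero hF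

theorem sum_star_mul_gram_mul (F : ι → H) (c : ι →₀ ℂ) :
    (c.sum fun i ci => c.sum fun j cj => star ci * Matrix.gram ℂ F i j * cj) =
      ((‖c.sum fun i ci => ci • F i‖ ^ 2 : ℝ) : ℂ) := by
  have h := inner_self_eq_norm_sq_to_K (𝕜 := ℂ) (c.sum fun i ci => ci • F i)
  rw [Complex.ofReal_pow]
  refine Eq.trans ?_ h
  simp only [Finsupp.sum, sum_inner, inner_sum, inner_smul_left, inner_smul_right,
    Matrix.gram_apply, RCLike.star_def, Finset.mul_sum]
  rw [Finset.sum_comm]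
  exact Finset.sum_congr rfl fun i _ => Finset.sum_congr rfl fun j _ => by ring

theorem sum_star_mul_one_mul [DecidableEq ι] (c : ι →₀ ℂ) :
    (c.sum fun i ci => c.sum fun j cj => star ci * (1 : Matrix ι ι ℂ) i j * cj) =
      ((c.sum fun _ ci => ‖ci‖ ^ 2 : ℝ) : ℂ) := by
  simp only [Finsupp.sum, Matrix.one_apply, mul_ite, mul_one, mul_zero, ite_mul, zero_mul,
    Finset.sum_ite_eq, Complex.ofReal_sum, Complex.ofReal_pow]
  refine Finset.sum_congr rfl fun i hi => ?_
  rw [if_pos hi, Complex.star_def, Complex.conj_mul']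

/-- Gram matrices of arbitrary families are positive semidefinite. -/
theorem posSemidef_gram_of_family (F : ι → H) : (Matrix.gram ℂ F).PosSemidef :=
  ⟨Matrix.isHermitian_gram ℂ F, fun c => by
    rw [sum_star_mul_gram_mul]; exact Complex.zero_le_real.2 (by positivity)⟩

/-- The right side bounds the synthesis map, the adjoint form of the Bessel inequality. Only
finitely supported `c` occur, so `ι` may be infinite. -/
theorem posSemidef_smul_one_sub_gram_iff [DecidableEq ι] {F : ι → H} {B : ℝ} :
    ((B : ℂ) • (1 : Matrix ι ι ℂ) - Matrix.gram ℂ F).PosSemidef ↔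
      ∀ c : ι →₀ ℂ, ‖c.sum fun i ci => ci • F i‖ ^ 2 ≤ B * c.sum fun _ ci => ‖ci‖ ^ 2 := by
  have hherm : ((B : ℂ) • (1 : Matrix ι ι ℂ) - Matrix.gram ℂ F).IsHermitian :=
    (Matrix.isHermitian_one.smul (Complex.conj_ofReal B)).sub (Matrix.isHermitian_gram ℂ F)
  rw [Matrix.PosSemidef, and_iff_right hherm]
  refine forall_congr' fun c => ?_
  have hc : (c.sum fun i ci => c.sum fun j cj =>
      star ci * ((B : ℂ) • (1 : Matrix ι ι ℂ) - Matrix.gram ℂ F) i j * cj) =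
      ((B * (c.sum fun _ ci => ‖ci‖ ^ 2) - ‖c.sum fun i ci => ci • F i‖ ^ 2 : ℝ) : ℂ) := by
    rw [Complex.ofReal_sub, Complex.ofReal_mul, ← sum_star_mul_gram_mul, ← sum_star_mul_one_mul]
    simp only [Finsupp.sum, Finset.mul_sum, ← Finset.sum_sub_distrib, Matrix.sub_apply,
      Matrix.smul_apply, smul_eq_mul]
    exact Finset.sum_congr rfl fun i _ => Finset.sum_congr rfl fun j _ => by ring
  rw [hc, Complex.zero_le_real, sub_nonneg]

/-- A family is Bessel if and only if its Gram matrix is bounded. -/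
theorem isBessel_iff_posSemidef [DecidableEq ι] {F : ι → H} :
    IsBessel F ↔
      ∃ B : ℝ, 0 < B ∧ ((B : ℂ) • (1 : Matrix ι ι ℂ) - Matrix.gram ℂ F).PosSemidef := by
  rw [isBessel_iff_finset_sum_le]
  refine exists_congr fun B => and_congr_right fun hB => ?_
  rw [posSemidef_smul_one_sub_gram_iff]
  constructor
  · intro h c
    set v := c.sum fun i ci => ci • F i with hv
    have h1 : ‖v‖ ^ 2 ≤ ∑ i ∈ c.support, ‖c i‖ * ‖inner ℂ (F i) v‖ := by
      have : inner ℂ v v = ∑ i ∈ c.support, star (c i) * inner ℂ (F i) v := by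
        conv_lhs => rw [hv, Finsupp.sum, sum_inner]
        simp only [inner_smul_left, RCLike.star_def]
        rfl
      have hn : ‖inner ℂ v v‖ = ‖v‖ ^ 2 := by
        rw [inner_self_eq_norm_sq_to_K, norm_pow, RCLike.norm_ofReal, abs_norm]
      rw [← hn, this]
      exact (norm_sum_le _ _).trans_eq
        (Finset.sum_congr rfl fun i _ => by rw [norm_mul, norm_star])
    have h2 := Finset.sum_mul_sq_le_sq_mul_sq c.support (fun i => ‖c i‖)
      (fun i => ‖inner ℂ (F i) v‖)
    have h3 := h v c.support
    have h4 : (0 : ℝ) ≤ ∑ i ∈ c.support, ‖c i‖ ^ 2 := by positivity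
    rw [Finsupp.sum]
    -- Cauchy-Schwarz with the Bessel bound at `v` itself; one factor `‖v‖ ^ 2` then cancels.
    have h5 : (‖v‖ ^ 2) ^ 2 ≤ (∑ i ∈ c.support, ‖c i‖ ^ 2) * (B * ‖v‖ ^ 2) :=
      (pow_le_pow_left₀ (by positivity) h1 2).trans (h2.trans (by gcongr))
    rcases (sq_nonneg ‖v‖).eq_or_lt with h0 | h0
    · rw [← h0]; positivity
    · refine le_of_mul_le_mul_right ?_ h0
      linarith
  · intro h f s
    classical
    -- Synthesizing from the coefficients of `f` on `s` gives a vector whose inner product with `f`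
    -- is `S`.
    let c : ι →₀ ℂ := Finsupp.onFinset s (fun i => if i ∈ s then inner ℂ (F i) f else 0)
      fun i hi => by by_contra h; simp [h] at hi
    set S := ∑ i ∈ s, ‖inner ℂ (F i) f‖ ^ 2 with hS
    have h1 : (c.sum fun _ ci => ‖ci‖ ^ 2) = S := by
      rw [Finsupp.onFinset_sum _ (by simp)]
      exact Finset.sum_congr rfl fun i hi => by simp [hi]
    have h2 : inner ℂ (c.sum fun i ci => ci • F i) f = (S : ℂ) := by
      rw [Finsupp.onFinset_sum _ (by simp), sum_inner, hS, Complex.ofReal_sum]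
      refine Finset.sum_congr rfl fun i hi => ?_
      rw [if_pos hi, inner_smul_left, Complex.conj_mul', Complex.ofReal_pow]
    have h3 := h c
    rw [h1] at h3
    have hS0 : 0 ≤ S := by positivity
    have h4 : S ≤ ‖c.sum fun i ci => ci • F i‖ * ‖f‖ := by
      have := norm_inner_le_norm (𝕜 := ℂ) (c.sum fun i ci => ci • F i) f
      rwa [h2, Complex.norm_real, Real.norm_of_nonneg hS0] at this
    rcases hS0.eq_or_lt with h0 | h0
    · rw [← h0]; positivity
    · refine le_of_mul_le_mul_right ?_ h0
      calc S * S = S ^ 2 := by ring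
        _ ≤ (‖c.sum fun i ci => ci • F i‖ * ‖f‖) ^ 2 := by gcongr
        _ = ‖c.sum fun i ci => ci • F i‖ ^ 2 * ‖f‖ ^ 2 := by ring
        _ ≤ B * S * ‖f‖ ^ 2 := by gcongr
        _ = _ := by ring

theorem posSemidef_finset_prod {A : κ → Matrix ι ι ℂ} (s : Finset κ)
    (hA : ∀ j ∈ s, (A j).PosSemidef) :
    (Matrix.of fun p q => ∏ j ∈ s, A j p q).PosSemidef := by
  classical
  induction s using Finset.induction_on with
  | empty =>
    -- The empty Hadamard product is the all-ones matrix.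
    have h := posSemidef_gram_of_family (fun _ : ι => (1 : ℂ))
    convert h using 1
    ext p q
    simp
  | insert a s ha ih =>
    have e : (Matrix.of fun p q => ∏ j ∈ insert a s, A j p q) =
        A a ⊙ Matrix.of fun p q => ∏ j ∈ s, A j p q := by
      ext p q
      simp [Finset.prod_insert ha]
    rw [e]
    exact (hA a (Finset.mem_insert_self a s)).hadamard
      (ih fun j hj => hA j (Finset.mem_insert_of_mem hj))

/-- Telescoping: `A A' - D D' = A (A' - D') + (A - D) D'` entrywise, and Schur's theorem applies to
each summand. -/
theorem posSemidef_finset_prod_sub_prod {A D : κ → Matrix ι ι ℂ} (s : Finset κ)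
    (hD : ∀ j ∈ s, (D j).PosSemidef) (hAD : ∀ j ∈ s, (A j - D j).PosSemidef) :
    (Matrix.of fun p q => ∏ j ∈ s, A j p q - ∏ j ∈ s, D j p q).PosSemidef := by
  classical
  induction s using Finset.induction_on with
  | empty =>
    have e : (Matrix.of fun p q : ι => ∏ j ∈ (∅ : Finset κ), A j p q - ∏ j ∈ ∅, D j p q) = 0 := by
      ext p q
      simp
    rw [e]
    exact Matrix.PosSemidef.zero
  | insert a s ha ih =>
    have hDs : ∀ j ∈ s, (D j).PosSemidef := fun j hj => hD j (Finset.mem_insert_of_mem hj)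
    have hADs : ∀ j ∈ s, (A j - D j).PosSemidef := fun j hj => hAD j (Finset.mem_insert_of_mem hj)
    have hA : (A a).PosSemidef := by
      simpa using (hAD a (Finset.mem_insert_self a s)).add (hD a (Finset.mem_insert_self a s))
    have e : (Matrix.of fun p q => ∏ j ∈ insert a s, A j p q - ∏ j ∈ insert a s, D j p q) =
        A a ⊙ (Matrix.of fun p q => ∏ j ∈ s, A j p q - ∏ j ∈ s, D j p q) +
          (A a - D a) ⊙ Matrix.of fun p q => ∏ j ∈ s, D j p q := by
      ext p q
      simp only [Finset.prod_insert ha, Matrix.of_apply, Matrix.add_apply, Matrix.hadamard_apply,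
        Matrix.sub_apply]
      ring
    rw [e]
    exact (hA.hadamard (ih hDs hADs)).add
      ((hAD a (Finset.mem_insert_self a s)).hadamard (posSemidef_finset_prod s hDs))

/-- Tensor products of Bessel families are Bessel. -/
theorem IsBessel.of_inner_eq_prod [Fintype κ] {K : Type*} [NormedAddCommGroup K]
    [InnerProductSpace ℂ K] {I : κ → Type*} {F : ∀ j, I j → H} (hF : ∀ j, IsBessel (F j))
    {T : ι → K} (e : ι → ∀ j, I j) (he : Function.Injective e)
    (hT : ∀ p q, inner ℂ (T p) (T q) = ∏ j, inner ℂ (F j (e p j)) (F j (e q j))) :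
    IsBessel T := by
  classical
  choose B hB hBF using fun j => isBessel_iff_posSemidef.1 (hF j)
  refine isBessel_iff_posSemidef.2 ⟨∏ j, B j, Finset.prod_pos fun j _ => hB j, ?_⟩
  have h := posSemidef_finset_prod_sub_prod
    (A := fun j => ((B j : ℂ) • (1 : Matrix (I j) (I j) ℂ)).submatrix (e · j) (e · j))
    (D := fun j => (Matrix.gram ℂ (F j)).submatrix (e · j) (e · j)) Finset.univ
    (fun j _ => (posSemidef_gram_of_family (F j)).submatrix _)
    (fun j _ => (hBF j).submatrix (e · j))
  convert h using 1
  ext p q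
  -- Injectivity of `e` is what makes the product of identity matrices the identity again.
  have h1 : ∏ j, (1 : Matrix (I j) (I j) ℂ) (e p j) (e q j) = (1 : Matrix ι ι ℂ) p q := by
    by_cases hpq : p = q
    · subst hpq; simp
    · obtain ⟨j, hj⟩ := Function.ne_iff.1 (he.ne hpq)
      rw [Matrix.one_apply_ne hpq]
      exact Finset.prod_eq_zero (Finset.mem_univ j) (Matrix.one_apply_ne hj)
  simp [hT, Finset.prod_mul_distrib, h1]

/-- Linearly independent finite families have a biorthogonal family. -/
theorem LinearIndependent.exists_inner_eq_single [Fintype κ] [DecidableEq κ] {v : κ → H}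
    (hv : LinearIndependent ℂ v) (k : κ) :
    ∃ f : H, ∀ l, inner ℂ (v l) f = if l = k then 1 else 0 := by
  let W := Submodule.span ℂ (Set.range v)
  let b := Module.Basis.span hv
  have : FiniteDimensional ℂ W := FiniteDimensional.span_of_finite ℂ (Set.finite_range v)
  -- Riesz representation of the `k`-th coordinate functional on the finite-dimensional span, so `H`
  -- need not be complete.
  let w : W := (InnerProductSpace.toDual ℂ W).symm (LinearMap.toContinuousLinearMap (b.coord k))
  refine ⟨w, fun l => ?_⟩
  have h : inner ℂ w (b l) = if l = k then 1 else 0 := by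
    rw [InnerProductSpace.toDual_symm_apply]
    simp [Finsupp.single_apply]
  have hb : ((b l : W) : H) = v l :=
    congrArg Subtype.val (Module.Basis.span_apply hv l)
  rw [← hb, ← inner_conj_symm, ← Submodule.coe_inner, h]
  split_ifs <;> simp

end Bessel

/-! ### Time-frequency shifts as isometries of L² -/

section TimeFrequencyShift

variable {E : Type*} [NormedAddCommGroup E] [InnerProductSpace ℝ E] [FiniteDimensional ℝ E]
  [MeasurableSpace E] [BorelSpace E]

theorem coeFn_tfShift (a b : E) (g : Lp ℂ 2 (volume : Measure E)) :
    tfShift a b g =ᵐ[volume] tfShiftFun a b g :=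
  MemLp.coeFn_toLp _

theorem tfShiftFun_congr_ae (a b : E) {f g : E → ℂ} (h : f =ᵐ[volume] g) :
    tfShiftFun a b f =ᵐ[volume] tfShiftFun a b g := by
  filter_upwards [(measurePreserving_sub_right volume a).quasiMeasurePreserving.ae h] with x hx
  simp only [tfShiftFun, hx]

theorem tfShift_add (a b : E) (f g : Lp ℂ 2 (volume : Measure E)) :
    tfShift a b (f + g) = tfShift a b f + tfShift a b g := by
  refine Lp.ext ?_
  filter_upwards [coeFn_tfShift a b (f + g), coeFn_tfShift a b f, coeFn_tfShift a b g,
    Lp.coeFn_add (tfShift a b f) (tfShift a b g),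
    tfShiftFun_congr_ae a b (Lp.coeFn_add f g)] with x h1 h2 h3 h4 h5
  rw [h1, h4, Pi.add_apply, h2, h3, h5]
  simp only [tfShiftFun, Pi.add_apply, mul_add]

theorem tfShift_smul (a b : E) (c : ℂ) (g : Lp ℂ 2 (volume : Measure E)) :
    tfShift a b (c • g) = c • tfShift a b g := by
  refine Lp.ext ?_
  filter_upwards [coeFn_tfShift a b (c • g), coeFn_tfShift a b g,
    Lp.coeFn_smul c (tfShift a b g), tfShiftFun_congr_ae a b (Lp.coeFn_smul c g)]
    with x h1 h2 h3 h4
  rw [h1, h3, Pi.smul_apply, h2, h4]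
  simp only [tfShiftFun, Pi.smul_apply, smul_eq_mul, mul_left_comm]

theorem norm_tfShift (a b : E) (g : Lp ℂ 2 (volume : Measure E)) : ‖tfShift a b g‖ = ‖g‖ := by
  rw [tfShift, Lp.norm_toLp, Lp.norm_def]
  congr 1
  rw [← eLpNorm_comp_measurePreserving (Lp.aestronglyMeasurable g)
    (measurePreserving_sub_right volume a)]
  refine eLpNorm_congr_norm_ae (Filter.Eventually.of_forall fun x => ?_)
  have he : ‖Complex.exp (2 * Real.pi * Complex.I * ((inner ℝ x b : ℝ) : ℂ))‖ = 1 := by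
    rw [Complex.norm_exp]
    simp
  rw [tfShiftFun, norm_mul, he, one_mul, Function.comp_apply]

/-- The time-frequency shift as a linear isometry of `L²`. -/
noncomputable def tfShiftIsometry (a b : E) :
    Lp ℂ 2 (volume : Measure E) →ₗᵢ[ℂ] Lp ℂ 2 (volume : Measure E) where
  toFun := tfShift a b
  map_add' := tfShift_add a b
  map_smul' := tfShift_smul a b
  norm_map' := norm_tfShift a b

@[simp]
theorem tfShiftIsometry_apply (a b : E) (g : Lp ℂ 2 (volume : Measure E)) :
    tfShiftIsometry a b g = tfShift a b g := rfl

end TimeFrequencyShift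

/-! ### Tensor products and the two implications -/

section Tensor

variable {d : ℕ}

theorem coeFn_tensorLp (g : Fin d → Lp ℂ 2 (volume : Measure ℝ)) :
    tensorLp g =ᵐ[volume] fun x => ∏ j, g j (x j) :=
  MemLp.coeFn_toLp _

theorem inner_tensorLp (f g : Fin d → Lp ℂ 2 (volume : Measure ℝ)) :
    inner ℂ (tensorLp f) (tensorLp g) = ∏ j, inner ℂ (f j) (g j) := by
  simp only [L2.inner_def]
  rw [← integral_fintype_prod_volume_eq_prod
    (fun j (x : ℝ) => (inner ℂ (f j x) (g j x) : ℂ)),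
    ← (PiLp.volume_preserving_ofLp (Fin d)).integral_comp
      (MeasurableEquiv.toLp 2 (Fin d → ℝ)).symm.measurableEmbedding]
  refine integral_congr_ae ?_
  filter_upwards [coeFn_tensorLp f, coeFn_tensorLp g] with x hf hg
  simp only [hf, hg, RCLike.inner_apply, map_prod, Finset.prod_mul_distrib]

/-- Almost everywhere equal factors have almost everywhere equal tensor products. -/
theorem prod_comp_apply_congr_ae {f g : Fin d → ℝ → ℂ} (h : ∀ j, f j =ᵐ[volume] g j) :
    (fun x : EuclideanSpace ℝ (Fin d) => ∏ j, f j (x j)) =ᵐ[volume]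
      fun x => ∏ j, g j (x j) := by
  have hq : ∀ j, Measure.QuasiMeasurePreserving
      (fun x : EuclideanSpace ℝ (Fin d) => x j) volume volume := fun j =>
    (Measure.quasiMeasurePreserving_eval (fun _ : Fin d => (volume : Measure ℝ)) j).comp
      (PiLp.volume_preserving_ofLp (Fin d)).quasiMeasurePreserving
  filter_upwards [ae_all_iff.2 fun j => (hq j).ae (h j)] with x hx
  exact Finset.prod_congr rfl fun j _ => hx j

theorem tfShift_tensorLp (a b : EuclideanSpace ℝ (Fin d))
    (g : Fin d → Lp ℂ 2 (volume : Measure ℝ)) :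
    tfShift a b (tensorLp g) = tensorLp fun j => tfShift (a j) (b j) (g j) := by
  refine Lp.ext ?_
  filter_upwards [coeFn_tfShift a b (tensorLp g), tfShiftFun_congr_ae a b (coeFn_tensorLp g),
    coeFn_tensorLp fun j => tfShift (a j) (b j) (g j),
    prod_comp_apply_congr_ae fun j => coeFn_tfShift (a j) (b j) (g j)] with x h1 h2 h3 h4
  rw [h1, h2, h3, h4]
  simp only [tfShiftFun, Finset.prod_mul_distrib, ← Complex.exp_sum, ← Finset.mul_sum,
    PiLp.inner_apply, Complex.ofReal_sum, PiLp.sub_apply]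

theorem gaborSystem_sum_tensorLp {r : ℕ} (gf : Fin d → Fin r → Lp ℂ 2 (volume : Measure ℝ))
    (Λ : Set (EuclideanSpace ℝ (Fin d) × EuclideanSpace ℝ (Fin d))) :
    gaborSystem (∑ k, tensorLp fun j => gf j k) Λ =
      ∑ k, fun p : Λ => tensorLp fun j => tfShift (p.1.1 j) (p.1.2 j) (gf j k) := by
  ext1 p
  rw [gaborSystem, ← tfShiftIsometry_apply, map_sum, Finset.sum_apply]
  simp only [tfShiftIsometry_apply, tfShift_tensorLp]

theorem isBessel_tensor_gaborSystem {Λ : Fin d → Set (ℝ × ℝ)}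
    {g : Fin d → Lp ℂ 2 (volume : Measure ℝ)} (hg : ∀ j, IsBessel (gaborSystem (g j) (Λ j))) :
    IsBessel fun p : timeFreqProd Λ => tensorLp fun j => tfShift (p.1.1 j) (p.1.2 j) (g j) := by
  refine IsBessel.of_inner_eq_prod hg (fun p j => ⟨(p.1.1 j, p.1.2 j), p.2 j⟩) ?_
    fun p q => inner_tensorLp _ _
  intro p q hpq
  have h : ∀ j, p.1.1 j = q.1.1 j ∧ p.1.2 j = q.1.2 j := fun j => by
    simpa using congrFun hpq j
  exact Subtype.ext (Prod.ext (PiLp.ext fun j => (h j).1) (PiLp.ext fun j => (h j).2))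

theorem isBessel_gaborSystem_of_tensor {r : ℕ} (hd : 1 < d)
    {gf : Fin d → Fin r → Lp ℂ 2 (volume : Measure ℝ)} (hind : ∀ j, LinearIndependent ℂ (gf j))
    {Λ : Fin d → Set (ℝ × ℝ)} (hΛ : ∀ j, (Λ j).Nonempty)
    (h : IsBessel (gaborSystem (∑ k, tensorLp fun j => gf j k) (timeFreqProd Λ)))
    (j₀ : Fin d) (k₀ : Fin r) : IsBessel (gaborSystem (gf j₀ k₀) (Λ j₀)) := by
  rw [gaborSystem_sum_tensorLp, isBessel_iff_finset_sum_le] at h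
  obtain ⟨B, hB, h⟩ := h
  choose μ hμ using hΛ
  have : Nontrivial (Fin d) := Fin.nontrivial_iff_two_le.2 hd
  obtain ⟨j₁, hj₁⟩ := exists_ne j₀
  obtain ⟨u, hu⟩ := ((hind j₁).map' (tfShiftIsometry (μ j₁).1 (μ j₁).2).toLinearMap
    (LinearMap.ker_eq_bot.2 (tfShiftIsometry (μ j₁).1 (μ j₁).2).injective)).exists_inner_eq_single
      k₀
  replace hu : ∀ l, inner ℂ (tfShift (μ j₁).1 (μ j₁).2 (gf j₁ l)) u = if l = k₀ then 1 else 0 := hu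
  -- Away from `j₁`, pairing each shifted factor with itself keeps `C` nonzero.
  let w : Fin d → Lp ℂ 2 (volume : Measure ℝ) := fun j =>
    if j = j₁ then u else tfShift (μ j).1 (μ j).2 (gf j k₀)
  set C : ℂ := ∏ j ∈ Finset.univ.erase j₀, inner ℂ (tfShift (μ j).1 (μ j).2 (gf j k₀)) (w j)
    with hC
  have hC0 : C ≠ 0 := by
    refine Finset.prod_ne_zero_iff.2 fun j _ => ?_
    by_cases hj : j = j₁
    · subst hj; simp [w, hu]
    · simp only [w, if_neg hj]
      rw [inner_self_ne_zero, ← norm_ne_zero_iff, norm_tfShift, norm_ne_zero_iff]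
      exact (hind j).ne_zero k₀
  -- The slice of the product set through `μ` in direction `j₀`.
  let lift : Λ j₀ → timeFreqProd Λ := fun p =>
    ⟨(WithLp.toLp 2 fun j => (Function.update μ j₀ p.1 j).1,
      WithLp.toLp 2 fun j => (Function.update μ j₀ p.1 j).2), fun j => by
        by_cases hj : j = j₀
        · subst hj; simp
        · simpa [Function.update_of_ne hj] using hμ j⟩
  have hlift : Function.Injective lift := fun p q hpq => by
    have h1 := congrArg (fun t : timeFreqProd Λ => (t.1.1 j₀, t.1.2 j₀)) hpq
    simpa [lift, Subtype.ext_iff, Prod.ext_iff] using h1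
  have key : ∀ (f : Lp ℂ 2 (volume : Measure ℝ)) (p : Λ j₀),
      inner ℂ ((∑ k, fun p : timeFreqProd Λ =>
        tensorLp fun j => tfShift (p.1.1 j) (p.1.2 j) (gf j k)) (lift p))
        (tensorLp (Function.update w j₀ f)) =
      C * inner ℂ (gaborSystem (gf j₀ k₀) (Λ j₀) p) f := by
    intro f p
    rw [Finset.sum_apply, sum_inner, Finset.sum_eq_single k₀]
    · rw [inner_tensorLp, ← Finset.prod_erase_mul _ _ (Finset.mem_univ j₀), hC]
      congr 1
      · refine Finset.prod_congr rfl fun j hj => ?_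
        have hj := Finset.ne_of_mem_erase hj
        simp [lift, Function.update_of_ne hj]
      · simp [lift, gaborSystem]
    · intro k _ hk
      rw [inner_tensorLp]
      refine Finset.prod_eq_zero (Finset.mem_univ j₁) ?_
      simp [lift, Function.update_of_ne hj₁, w, hu, hk]
    · simp
  set M : ℝ := ∏ j ∈ Finset.univ.erase j₀, ‖w j‖ ^ 2 with hM
  have hnorm : ∀ f, ‖tensorLp (Function.update w j₀ f)‖ ^ 2 = M * ‖f‖ ^ 2 := by
    intro f
    have h1 : ((‖tensorLp (Function.update w j₀ f)‖ ^ 2 : ℝ) : ℂ) = ((M * ‖f‖ ^ 2 : ℝ) : ℂ) := by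
      have h2 := inner_tensorLp (Function.update w j₀ f) (Function.update w j₀ f)
      simp only [inner_self_eq_norm_sq_to_K] at h2
      rw [← Finset.prod_erase_mul _ _ (Finset.mem_univ j₀), Function.update_self,
        Finset.prod_congr rfl fun j hj => by
          rw [Function.update_of_ne (Finset.ne_of_mem_erase hj)]] at h2
      rw [hM]
      push_cast
      exact h2
    exact_mod_cast h1
  have hM0 : 0 ≤ M := Finset.prod_nonneg fun j _ => by positivity
  have hCpos : 0 < ‖C‖ ^ 2 := by positivity
  -- The `+ 1` makes the bound positive, since only `0 ≤ M` has been shown.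
  refine isBessel_iff_finset_sum_le.2 ⟨(B * M + 1) / ‖C‖ ^ 2, by positivity, fun f s => ?_⟩
  have h1 := h (tensorLp (Function.update w j₀ f)) (s.map ⟨lift, hlift⟩)
  rw [Finset.sum_map, hnorm] at h1
  simp only [Function.Embedding.coeFn_mk, key, norm_mul, mul_pow, ← Finset.mul_sum] at h1
  rw [div_mul_eq_mul_div, le_div_iff₀ hCpos, mul_comm]
  nlinarith [sq_nonneg ‖f‖]

end Tensor

theorem proposition4p1 (d : ℕ) (hd : 1 < d) (r : ℕ)
    (gf : Fin d → Fin r → Lp ℂ 2 (volume : Measure ℝ))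
    (hind : ∀ j, LinearIndependent ℂ (gf j))
    (g : Lp ℂ 2 (volume : Measure (EuclideanSpace ℝ (Fin d))))
    (hg : g = ∑ k, tensorLp (fun j => gf j k))
    (Λ : Fin d → Set (ℝ × ℝ)) (hΛ : ∀ j, (Λ j).Nonempty) :
    IsBessel (gaborSystem g (timeFreqProd Λ)) ↔
      ∀ (j : Fin d) (k : Fin r), IsBessel (gaborSystem (gf j k) (Λ j)) := by
  subst hg
  refine ⟨isBessel_gaborSystem_of_tensor hd hind hΛ, fun h => ?_⟩
  rw [gaborSystem_sum_tensorLp]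
  exact IsBessel.sum Finset.univ fun k _ => isBessel_tensor_gaborSystem fun j => h j k
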